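/- **Theorem.** Let $n,k,L$ be positive integers with $k\le n$, let $\mathbb F$ be a finite field, and put $$c(n,k,L)=2Ln^2\binom{n}{\le n-k}^{L+1},\qquad \binom{n}{\le m}=\sum_{i=0}^{m}\binom ni .$$ Choose $\alpha_1,\dots,\alpha_n\in\mathbb F$ uniformly and independently, and let $C\subseteq\mathbb F^n$ be the row space of the $k\times n$ Vandermonde matrix with entries $\alpha_i^{\,j}$ ($0\le j\le k-1$, $1\le i\le n$). Let $R=k/n$. Then, with probability at least $1-c(n,k,L)/|\mathbb F|$, all of the following hold simultaneously: 1. the $\alpha_i$ are pairwise distinct and $\dim C=k$, i.e. $C$ is an $(n,k)$-Reed–Solomon code; 2. $C$ is LD-MDS$(\le L)$; 3. $C$ is $\left(1-R-\frac{1-R}{L+1},L\right)$-average-radius list decodable; 4. $C$ is $\left(\frac{\ell}{\ell+1}(1-R),\ell\right)$-list decodable for every $1\le \ell\le L$. Here, writing $\mathrm{wt}$ for Hamming weight, a linear code $C\subseteq\mathbb F^n$ is *$(\rho,\ell)$-list decodable* if for every $y\in\mathbb F^n$ at most $\ell$ codewords $x\in C$ satisfy $\mathrm{wt}(x-y)\le\rho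 n$. It is *$(\rho,\ell)$-average-radius list decodable* if there are no $y\in\mathbb F^n$ and $\ell+1$ distinct codewords $c_0,\dots,c_\ell\in C$ with $\frac1{\ell+1}\sum_{i=0}^{\ell}\mathrm{wt}(c_i-y)\le\rho n$. It is *LD-MDS$(\ell)$* if it is $\left(\frac{\ell}{\ell+1}\left(1-\frac{\dim C}{n}\right),\ell\right)$-average-radius list decodable, and *LD-MDS$(\le L)$* if it is LD-MDS$(\ell)$ for all $1\le\ell\le L$. -/

import Mathlib

/-- A linear code `C ⊆ Fⁿ` is `(ρ, L)`-list decodable: every Hamming ball of radius `ρ n`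
contains at most `L` codewords. -/
def IsListDecodable {F : Type*} [Field F] [DecidableEq F] {n : ℕ}
    (C : Submodule F (Fin n → F)) (ρ : ℝ) (L : ℕ) : Prop :=
  ∀ y : Fin n → F,
    {c : Fin n → F | c ∈ C ∧ (hammingNorm (c - y) : ℝ) ≤ ρ * n}.encard ≤ L

/-- A linear code `C ⊆ Fⁿ` is `(ρ, L)`-average-radius list decodable: there are no `L + 1` distinct
codewords whose average Hamming distance to some word `y` is at most `ρ n`. -/
def IsAvgRadiusListDecodable {F : Type*} [Field F] [DecidableEq F] {n : ℕ}
    (C : Submodule F (Fin n → F)) (ρ : ℝ) (L : ℕ) : Prop :=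
  ¬ ∃ (c : Fin (L + 1) → Fin n → F) (y : Fin n → F),
    Function.Injective c ∧ (∀ i, c i ∈ C) ∧
      (1 / ((L : ℝ) + 1)) * ∑ i, (hammingNorm (c i - y) : ℝ) ≤ ρ * n

/-- `LD-MDS(L)`: a linear code of length `n` and dimension `k` that is average-radius list decodable
with list size `L` and radius `L / (L + 1) * (1 - k / n)`. -/
def IsLDMDS {F : Type*} [Field F] [DecidableEq F] {n : ℕ}
    (C : Submodule F (Fin n → F)) (L : ℕ) : Prop :=
  IsAvgRadiusListDecodable C
    ((L : ℝ) / ((L : ℝ) + 1) * (1 - (Module.finrank F C : ℝ) / (n : ℝ))) L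

/-- `LD-MDS(≤ L)`: `LD-MDS(ℓ)` for all `1 ≤ ℓ ≤ L`. -/
def IsLDMDSLE {F : Type*} [Field F] [DecidableEq F] {n : ℕ}
    (C : Submodule F (Fin n → F)) (L : ℕ) : Prop :=
  ∀ ℓ : ℕ, 1 ≤ ℓ → ℓ ≤ L → IsLDMDS C ℓ

/-- The `k × n` Vandermonde matrix with rows `(α₁ ^ j, …, αₙ ^ j)`, `0 ≤ j < k`. -/
def vandermondeGenerator {F : Type*} [Field F] {n : ℕ} (k : ℕ) (α : Fin n → F) :
    Matrix (Fin k) (Fin n) F :=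
  Matrix.of fun j i => α i ^ (j : ℕ)

/-- The code generated by (that is, the row space of) the `k × n` Vandermonde matrix of `α`.
It is an `(n, k)`-Reed–Solomon code when the `α i` are pairwise distinct. -/
def reedSolomonCode {F : Type*} [Field F] {n : ℕ} (k : ℕ) (α : Fin n → F) :
    Submodule F (Fin n → F) :=
  Submodule.span F (Set.range (vandermondeGenerator k α).row)

/-- `binom(n, ≤ m) = ∑_{i = 0}^m binom(n, i)`. -/
def chooseLE (n m : ℕ) : ℕ := ∑ i ∈ Finset.range (m + 1), n.choose i

open Finset Polynomial

/-! Put m = n - k. The dual of a Reed–Solomon code is a generalized Reed–Solomon code, so a received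
word y has a syndrome functional φ(g) = ∑ v_j y_j g(α_j) on polynomials of degree < m, unchanged
when a codeword is subtracted from y. If a codeword c_i differs from y exactly on E_i, then φ kills
all multiples of ∏_{j ∈ E_i} (X - α_j). If these multiples, over all i, span the polynomials of
degree < m, then φ = 0; each c_i - y is supported on at most m coordinates, hence vanishes, and all
codewords coincide (`codeword_eq_of_spanning`).

A violation of average-radius decodability has ∑ #E_i ≤ ℓ m, so the spaces of multiples have total
dimension at least m. For a minimal violation (`exists_minimal_violation`) they can be trimmed to
total dimension m while satisfying a Hall condition (`exists_hallCondition`): for every subfamily,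
the multiples of its common factor leave enough room for the sum of its dimensions. The GM-MDS
theorem `exists_generic_syzygyFree` says that at generic points this necessary condition suffices
for independence, hence for spanning.

Genericity is the nonvanishing of an m × m determinant of degree at most m² in α
(`exists_spanning_polynomial`). Multiplying these determinants over all tuples of error patterns,
together with the differences α_i - α_j, gives one polynomial to which Schwartz–Zippel applies. -/

/-- `X ^ t * ∏_{j ∈ S} (X - a j)`. -/
noncomputable def nodalShift {σ R : Type*} [CommRing R] (a : σ → R) (S : Finset σ) (t : ℕ) : R[X] :=
  X ^ t * ∏ j ∈ S, (X - C (a j))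

/-- There is no nontrivial relation `∑ nodalShift a (S i) (t i) * q i = 0` with `deg (q i) < d i`. -/
def SyzygyFree {σ ι K : Type*} [Field K] (s : Finset ι) (S : ι → Finset σ) (t d : ι → ℕ)
    (a : σ → K) : Prop :=
  ∀ q : ι → K[X], (∀ i ∈ s, (q i).degree < (d i : WithBot ℕ)) →
    ∑ i ∈ s, nodalShift a (S i) (t i) * q i = 0 → ∀ i ∈ s, q i = 0

/-- The combinatorial condition of the GM-MDS theorem, with one special point of multiplicity
`t i` in the `i`-th zero pattern. -/
def HallCondition {σ ι : Type*} [Fintype σ] [DecidableEq σ] (s : Finset ι) (S : ι → Finset σ)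
    (t d : ι → ℕ) (m : ℕ) : Prop :=
  (∀ i ∈ s, #(S i) + t i + d i = m) ∧
    ∀ J ⊆ s, J.Nonempty → ∃ i ∈ J, ∑ j ∈ J, d j + #(J.inf S) + t i ≤ m

/-! ### Algebra of shifted nodal polynomials. -/

section NodalShift

variable {σ R : Type*} [CommRing R]

lemma nodalShift_map {R' : Type*} [CommRing R'] (f : R →+* R') (a : σ → R) (S : Finset σ) (t : ℕ) :
    (nodalShift a S t).map f = nodalShift (fun j => f (a j)) S t := by
  simp [nodalShift, Polynomial.map_prod]

lemma nodalShift_monic (a : σ → R) (S : Finset σ) (t : ℕ) : (nodalShift a S t).Monic :=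
  (monic_X_pow t).mul (monic_prod_of_monic _ _ fun j _ => monic_X_sub_C (a j))

lemma nodalShift_natDegree [Nontrivial R] (a : σ → R) (S : Finset σ) (t : ℕ) :
    (nodalShift a S t).natDegree = #S + t := by
  rw [nodalShift, (monic_X_pow t).natDegree_mul (monic_prod_of_monic _ _ fun j _ => monic_X_sub_C (a j)),
    natDegree_X_pow, natDegree_prod_of_monic _ _ fun j _ => monic_X_sub_C (a j)]
  simp [add_comm]

lemma nodalShift_add (a : σ → R) (S : Finset σ) (t l : ℕ) :
    nodalShift a S (t + l) = X ^ l * nodalShift a S t := by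
  simp only [nodalShift, pow_add]; ring

lemma nodalShift_dvd (a : σ → R) {S S' : Finset σ} {t t' : ℕ} (hS : S ⊆ S') (ht : t ≤ t') :
    nodalShift a S t ∣ nodalShift a S' t' :=
  mul_dvd_mul (pow_dvd_pow _ ht) (prod_dvd_prod_of_subset _ _ _ hS)

lemma nodalShift_erase [DecidableEq σ] {a : σ → R} {S : Finset σ} {t : ℕ} {j : σ} (hj : j ∈ S)
    (ha : a j = 0) : nodalShift a S t = nodalShift a (S.erase j) (t + 1) := by
  rw [nodalShift, ← mul_prod_erase S _ hj, ha, nodalShift, map_zero, sub_zero]; ring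

lemma nodalShift_congr {a b : σ → R} {S : Finset σ} {t : ℕ} (h : ∀ j ∈ S, a j = b j) :
    nodalShift a S t = nodalShift b S t := by
  rw [nodalShift, nodalShift, prod_congr rfl fun j hj => by rw [h j hj]]

end NodalShift

lemma eq_sum_range_of_degree_lt {R : Type*} [Semiring R] {p : R[X]} {d : ℕ}
    (h : p.degree < (d : WithBot ℕ)) : p = ∑ l ∈ range d, C (p.coeff l) * X ^ l := by
  ext l
  by_cases hl : l < d
  · simp [finsetSum_coeff, coeff_C_mul, coeff_X_pow, hl]
  · rw [coeff_eq_zero_of_degree_lt (h.trans_le (by exact_mod_cast not_lt.1 hl))]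
    simp [finsetSum_coeff, coeff_C_mul, coeff_X_pow, hl]

/-! ### Independence as a Zariski open condition on the points. -/

section Generic

variable {σ ι K : Type*} [Field K]

/-- Expanding each `q i` in its coefficients turns a syzygy into a scalar relation among the shifts
by `X ^ l`; in this form determinants apply. -/
lemma syzygyFree_iff_linearIndepOn (s : Finset ι) (S : ι → Finset σ) (t d : ι → ℕ) (a : σ → K) :
    SyzygyFree s S t d a ↔
      LinearIndepOn K (fun x : Σ _ : ι, ℕ => nodalShift a (S x.1) (t x.1 + x.2))
        (s.sigma fun i => range (d i) : Finset (Σ _ : ι, ℕ)) := by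
  rw [linearIndepOn_finset_iff]
  constructor
  · intro h f hf x hx
    rw [mem_sigma, mem_range] at hx
    have key := h (fun i => ∑ l ∈ range (d i), monomial l (f ⟨i, l⟩)) (fun i _ => by
      refine (degree_sum_le _ _).trans_lt ((Finset.sup_lt_iff (WithBot.bot_lt_coe _)).2 fun l hl => ?_)
      exact (degree_monomial_le _ _).trans_lt (by exact_mod_cast mem_range.1 hl)) (by
      rw [← hf, sum_sigma]
      refine sum_congr rfl fun i _ => ?_
      rw [mul_sum]
      refine sum_congr rfl fun l _ => ?_
      rw [nodalShift_add, ← C_mul_X_pow_eq_monomial, smul_eq_C_mul]; ring) x.1 hx.1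
    have := congrArg (fun p => coeff p x.2) key
    simpa [finsetSum_coeff, coeff_monomial, hx.2] using this
  · intro h q hq hsum i hi
    have key := h (fun x => (q x.1).coeff x.2) (by
      rw [← hsum, sum_sigma]
      refine sum_congr rfl fun i hi => ?_
      conv_rhs => rw [eq_sum_range_of_degree_lt (hq i hi), mul_sum]
      refine sum_congr rfl fun l _ => ?_
      rw [nodalShift_add, smul_eq_C_mul]; ring)
    ext l
    by_cases hl : l < d i
    · simpa using key ⟨i, l⟩ (by simp [hi, hl])
    · simpa using coeff_eq_zero_of_degree_lt ((hq i hi).trans_le (by exact_mod_cast not_lt.1 hl))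

/-- Linear independence of polynomials with parameters is a Zariski open condition. -/
lemma exists_polynomial_linearIndependent {β : Type*} [Fintype β] [DecidableEq β]
    (p : β → (MvPolynomial σ K)[X]) (a : σ → K)
    (h : LinearIndependent K fun b => (p b).map (MvPolynomial.eval a)) :
    ∃ Q : MvPolynomial σ K, MvPolynomial.eval a Q ≠ 0 ∧ ∀ a' : σ → K, MvPolynomial.eval a' Q ≠ 0 →
      LinearIndependent K fun b => (p b).map (MvPolynomial.eval a') := by
  -- Composing the family with a left inverse found at `a` gives a square matrix, polynomial in the
  -- parameters, which is the identity at `a`.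
  obtain ⟨g, hg⟩ := LinearMap.exists_leftInverse_of_injective
    (Fintype.linearCombination K fun b => (p b).map (MvPolynomial.eval a))
    (LinearMap.ker_eq_bot.2 h.fintypeLinearCombination_injective)
  let N : Matrix β β (MvPolynomial σ K) := Matrix.of fun c b =>
    ∑ r ∈ range ((p b).natDegree + 1), MvPolynomial.C (g (X ^ r) c) * (p b).coeff r
  have hN : ∀ x : σ → K, MvPolynomial.eval x N.det =
      (Matrix.of fun c b => g ((p b).map (MvPolynomial.eval x)) c).det := by
    intro x
    rw [RingHom.map_det]
    congr 1
    ext c b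
    conv_rhs => rw [Matrix.of_apply, (p b).as_sum_range_C_mul_X_pow]
    simp only [N, RingHom.mapMatrix_apply, Matrix.map_apply, Matrix.of_apply, map_sum, map_mul,
      MvPolynomial.eval_C, Polynomial.map_sum, Polynomial.map_mul, Polynomial.map_C,
      Polynomial.map_pow, Polynomial.map_X, Finset.sum_apply]
    refine sum_congr rfl fun r _ => ?_
    rw [← smul_eq_C_mul, map_smul, Pi.smul_apply, smul_eq_mul, mul_comm]
  refine ⟨N.det, ?_, fun x hx => ?_⟩
  · rw [hN]
    have : (Matrix.of fun c b => g ((p b).map (MvPolynomial.eval a)) c) = 1 := by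
      ext c b
      have := congrFun (LinearMap.congr_fun hg (Pi.single b 1)) c
      simpa [Matrix.one_apply, Pi.single_apply] using this
    rw [this]; simp
  · rw [hN] at hx
    refine LinearIndependent.of_comp g ?_
    exact Matrix.linearIndependent_cols_of_det_ne_zero hx

lemma exists_polynomial_syzygyFree {s : Finset ι} {S : ι → Finset σ} {t d : ι → ℕ} {a : σ → K}
    (h : SyzygyFree s S t d a) :
    ∃ Q : MvPolynomial σ K, MvPolynomial.eval a Q ≠ 0 ∧
      ∀ a' : σ → K, MvPolynomial.eval a' Q ≠ 0 → SyzygyFree s S t d a' := by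
  classical
  have key : ∀ b : σ → K, SyzygyFree s S t d b ↔ LinearIndependent K
      fun x : (s.sigma fun i => range (d i) : Finset (Σ _ : ι, ℕ)) =>
        (nodalShift MvPolynomial.X (S x.1.1) (t x.1.1 + x.1.2)).map (MvPolynomial.eval b) := by
    intro b
    rw [syzygyFree_iff_linearIndepOn]
    simp only [nodalShift_map, MvPolynomial.eval_X]
    rfl
  simp only [key] at h ⊢
  exact exists_polynomial_linearIndependent _ a h

end Generic

/-! ### Reduction steps for the induction: syzygies and the Hall condition. -/

section Reductions

variable {σ ι K : Type*} [Field K] {s : Finset ι} {S : ι → Finset σ} {t d : ι → ℕ} {m : ℕ}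

lemma SyzygyFree.of_erase [DecidableEq ι] {a : σ → K} {i : ι} (hd : d i = 0)
    (h : SyzygyFree (s.erase i) S t d a) : SyzygyFree s S t d a := by
  intro q hq hsum j hj
  have h0 : i ∈ s → q i = 0 := fun hi => by
    have := hq i hi
    rw [hd] at this
    ext l
    simpa using coeff_eq_zero_of_degree_lt (this.trans_le (by simp))
  by_cases hji : j = i
  · exact hji ▸ h0 (hji ▸ hj)
  · refine h q (fun j hj => hq j (mem_of_mem_erase hj)) ?_ j (mem_erase.2 ⟨hji, hj⟩)
    rw [← hsum]
    by_cases hi : i ∈ s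
    · rw [← add_sum_erase s _ hi, h0 hi, mul_zero, zero_add]
    · rw [erase_eq_of_notMem hi]

lemma SyzygyFree.of_pred {a : σ → K} (ht : ∀ i ∈ s, 1 ≤ t i)
    (h : SyzygyFree s S (fun i => t i - 1) d a) : SyzygyFree s S t d a := by
  intro q hq hsum
  refine h q hq ?_
  have : X * ∑ i ∈ s, nodalShift a (S i) (t i - 1) * q i = 0 := by
    rw [← hsum, mul_sum]
    refine sum_congr rfl fun i hi => ?_
    conv_rhs => rw [← Nat.sub_add_cancel (ht i hi), nodalShift_add]
    ring
  exact (mul_eq_zero.1 this).resolve_left X_ne_zero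

/-- If exactly one of the patterns misses the special point `0`, the relation can be divided by
`X`. -/
lemma SyzygyFree.of_unique_zero [DecidableEq ι] {a : σ → K} {i₀ : ι} (hi₀ : i₀ ∈ s)
    (ht₀ : t i₀ = 0) (hd₀ : 1 ≤ d i₀)
    (ht : ∀ i ∈ s, i ≠ i₀ → 1 ≤ t i) (ha : ∀ j, a j ≠ 0)
    (h : SyzygyFree s S (fun i => t i - 1) (Function.update d i₀ (d i₀ - 1)) a) :
    SyzygyFree s S t d a := by
  intro q hq hsum
  -- At `0` all other blocks vanish, while the nodal polynomial of `i₀` does not.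
  have hdiv : X ∣ q i₀ := by
    rw [X_dvd_iff, coeff_zero_eq_eval_zero]
    have := congrArg (eval 0) hsum
    rw [eval_finsetSum, sum_eq_single_of_mem i₀ hi₀] at this
    · rw [eval_mul, eval_zero, mul_eq_zero] at this
      refine this.resolve_left ?_
      simp [nodalShift, ht₀, eval_prod, prod_eq_zero_iff, ha]
    · intro i hi hne
      have := ht i hi hne
      simp [nodalShift, show t i ≠ 0 by omega]
  obtain ⟨r, hr⟩ := hdiv
  have key := h (Function.update q i₀ r) (fun i hi => by
    by_cases hne : i = i₀
    · subst hne
      rw [Function.update_self, Function.update_self]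
      by_cases hr0 : r = 0
      · rw [hr0, degree_zero]; exact WithBot.bot_lt_coe _
      · have := hq i hi
        rw [hr, degree_mul, degree_X, degree_eq_natDegree hr0] at this
        rw [degree_eq_natDegree hr0]
        have h2 : 1 + r.natDegree < d i := by exact_mod_cast this
        exact_mod_cast (by omega : r.natDegree < d i - 1)
    · simpa [Function.update_of_ne hne] using hq i hi) (by
    have : X * ∑ i ∈ s, nodalShift a (S i) (t i - 1) * Function.update q i₀ r i = 0 := by
      rw [← hsum, mul_sum]
      refine sum_congr rfl fun i hi => ?_
      by_cases hne : i = i₀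
      · subst hne
        rw [Function.update_self, hr, ht₀]; ring
      · rw [Function.update_of_ne hne]
        conv_rhs => rw [← Nat.sub_add_cancel (ht i hi hne), nodalShift_add]
        ring
    exact (mul_eq_zero.1 this).resolve_left X_ne_zero)
  intro i hi
  have hk := key i hi
  by_cases hne : i = i₀
  · subst hne
    rw [Function.update_self] at hk
    rw [hr, hk, mul_zero]
  · simpa [Function.update_of_ne hne] using hk

/-- The blocks of a subset `J` may be replaced by a single block generated by their common
factor. -/
lemma SyzygyFree.of_contract [DecidableEq ι] [Fintype σ] [DecidableEq σ] {a : σ → K}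
    {J : Finset ι} (hJ : J ⊆ s) {i₀ : ι} (hi₀ : i₀ ∈ J) (ht₀ : ∀ i ∈ J, t i₀ ≤ t i)
    (hm : ∀ i ∈ J, #(S i) + t i + d i ≤ #(J.inf S) + t i₀ + ∑ j ∈ J, d j)
    (hA : SyzygyFree J S t d a)
    (hB : SyzygyFree (insert i₀ (s \ J)) (Function.update S i₀ (J.inf S)) t
      (Function.update d i₀ (∑ j ∈ J, d j)) a) :
    SyzygyFree s S t d a := by
  intro q hq hsum
  have hdvd : nodalShift a (J.inf S) (t i₀) ∣ ∑ i ∈ J, nodalShift a (S i) (t i) * q i :=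
    dvd_sum fun i hi => (nodalShift_dvd a (Finset.inf_le hi) (ht₀ i hi)).mul_right _
  -- The part of the relation indexed by `J` is the common factor times `r`. Then `hB` kills `r` and
  -- the blocks outside `J`, after which `hA` kills those inside.
  obtain ⟨r, hr⟩ := hdvd
  have hsplit : ∑ i ∈ s \ J, nodalShift a (S i) (t i) * q i
      + ∑ i ∈ J, nodalShift a (S i) (t i) * q i = 0 := by rw [sum_sdiff hJ, hsum]
  have hnot : i₀ ∉ s \ J := by simp [hi₀]
  have hne : ∀ i ∈ s \ J, i ≠ i₀ := fun i hi h => hnot (h ▸ hi)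
  have key := hB (Function.update q i₀ r) (fun i hi => by
    rcases mem_insert.1 hi with rfl | hi
    · rw [Function.update_self, Function.update_self]
      by_cases hr0 : r = 0
      · rw [hr0, degree_zero]; exact WithBot.bot_lt_coe _
      have hlt : (∑ i ∈ J, nodalShift a (S i) (t i) * q i).degree <
          ((#(J.inf S) + t i + ∑ j ∈ J, d j : ℕ) : WithBot ℕ) := by
        refine (degree_sum_le _ _).trans_lt
          ((Finset.sup_lt_iff (WithBot.bot_lt_coe _)).2 fun l hl => ?_)
        by_cases hq0 : q l = 0
        · rw [hq0, mul_zero, degree_zero]; exact WithBot.bot_lt_coe _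
        have h1 := hq l (hJ hl)
        rw [degree_eq_natDegree hq0] at h1
        rw [degree_mul, degree_eq_natDegree (nodalShift_monic _ _ _).ne_zero, nodalShift_natDegree,
          degree_eq_natDegree hq0]
        have h2 : (q l).natDegree < d l := by exact_mod_cast h1
        have h3 := hm l hl
        exact_mod_cast (by omega : #(S l) + t l + (q l).natDegree < _)
      rw [hr, degree_mul, degree_eq_natDegree (nodalShift_monic _ _ _).ne_zero,
        nodalShift_natDegree, degree_eq_natDegree hr0] at hlt
      rw [degree_eq_natDegree hr0]
      have h2 : #(J.inf S) + t i + r.natDegree < #(J.inf S) + t i + ∑ j ∈ J, d j := by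
        exact_mod_cast hlt
      exact_mod_cast (by omega : r.natDegree < ∑ j ∈ J, d j)
    · rw [Function.update_of_ne (hne i hi), Function.update_of_ne (hne i hi)]
      exact hq i (mem_sdiff.1 hi).1) (by
    rw [sum_insert hnot, Function.update_self, Function.update_self, ← hr, ← hsplit, add_comm]
    congr 1
    refine sum_congr rfl fun i hi => ?_
    rw [Function.update_of_ne (hne i hi), Function.update_of_ne (hne i hi)])
  have hr0 : r = 0 := by simpa using key i₀ (mem_insert_self _ _)
  have hJ0 := hA q (fun i hi => hq i (hJ hi)) (by rw [hr, hr0, mul_zero])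
  intro i hi
  by_cases hiJ : i ∈ J
  · exact hJ0 i hiJ
  · have hi' := mem_sdiff.2 ⟨hi, hiJ⟩
    simpa [Function.update_of_ne (hne i hi')] using key i (mem_insert_of_mem hi')

variable [Fintype σ] [DecidableEq σ]

lemma HallCondition.mono {s' : Finset ι} (h : HallCondition s S t d m) (hs : s' ⊆ s) :
    HallCondition s' S t d m :=
  ⟨fun i hi => h.1 i (hs hi), fun J hJ => h.2 J (hJ.trans hs)⟩

lemma HallCondition.pred (h : HallCondition s S t d m) (ht : ∀ i ∈ s, 1 ≤ t i) :
    HallCondition s S (fun i => t i - 1) d (m - 1) := by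
  refine ⟨fun i hi => ?_, fun J hJ hne => ?_⟩
  · have := h.1 i hi; have := ht i hi; dsimp only; omega
  · obtain ⟨i, hi, hle⟩ := h.2 J hJ hne
    have := ht i (hJ hi)
    exact ⟨i, hi, by dsimp only; omega⟩

/-- Truncated subtraction keeps `t i₀ = 0`, so for families containing `i₀` the drop in `m` is paid
for by `d i₀`; for the others every `t i` really drops. -/
lemma HallCondition.unique_zero [DecidableEq ι] {i₀ : ι} (h : HallCondition s S t d m)
    (hi₀ : i₀ ∈ s) (ht₀ : t i₀ = 0) (hd₀ : 1 ≤ d i₀) (ht : ∀ i ∈ s, i ≠ i₀ → 1 ≤ t i) :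
    HallCondition s S (fun i => t i - 1) (Function.update d i₀ (d i₀ - 1)) (m - 1) := by
  refine ⟨fun i hi => ?_, fun J hJ hne => ?_⟩
  · have h1 := h.1 i hi
    by_cases hne : i = i₀
    · subst hne; rw [Function.update_self]; beta_reduce; omega
    · have := ht i hi hne
      rw [Function.update_of_ne hne]; beta_reduce; omega
  · obtain ⟨i, hi, hle⟩ := h.2 J hJ hne
    by_cases hmem : i₀ ∈ J
    · refine ⟨i₀, hmem, ?_⟩
      rw [sum_update_of_mem hmem]
      rw [← add_sum_erase J d hmem, erase_eq] at hle
      by_cases hi' : i = i₀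
      · subst hi'; beta_reduce; omega
      · beta_reduce; omega
    · refine ⟨i, hi, ?_⟩
      have := ht i (hJ hi) (fun h => hmem (h ▸ hi))
      rw [sum_update_of_notMem hmem]
      beta_reduce
      omega

/-- A family containing the merged block is compared with the original one in which that block is
expanded to `J`: dimensions and intersections agree, and a witness in `J` may be replaced by `i₀`,
where `t` is least. Tightness gives the merged block the right size. -/
lemma HallCondition.contract [DecidableEq ι] (h : HallCondition s S t d m) {J : Finset ι}
    (hJ : J ⊆ s) {i₀ : ι} (hi₀ : i₀ ∈ J) (ht₀ : ∀ i ∈ J, t i₀ ≤ t i)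
    (htight : ∑ j ∈ J, d j + #(J.inf S) + t i₀ = m) :
    HallCondition (insert i₀ (s \ J)) (Function.update S i₀ (J.inf S)) t
      (Function.update d i₀ (∑ j ∈ J, d j)) m := by
  have hnot : i₀ ∉ s \ J := by simp [hi₀]
  have hupd : ∀ J' : Finset ι, i₀ ∉ J' → J'.inf (Function.update S i₀ (J.inf S)) = J'.inf S :=
    fun J' hJ' => Finset.inf_congr rfl fun i hi =>
      Function.update_of_ne (ne_of_mem_of_not_mem hi hJ') _ _
  refine ⟨fun i hi => ?_, fun J' hJ' hne => ?_⟩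
  · rcases mem_insert.1 hi with rfl | hi
    · rw [Function.update_self, Function.update_self]; omega
    · have hne : i ≠ i₀ := fun h => hnot (h ▸ hi)
      rw [Function.update_of_ne hne, Function.update_of_ne hne]
      exact h.1 i (mem_sdiff.1 hi).1
  · by_cases hmem : i₀ ∈ J'
    · have hsub : J' \ {i₀} ⊆ s \ J := fun i hi => by
        obtain ⟨h1, h2⟩ := mem_sdiff.1 hi
        exact (mem_insert.1 (hJ' h1)).resolve_left (by simpa using h2)
      have hdisj : Disjoint J (J' \ {i₀}) := disjoint_of_subset_right hsub disjoint_sdiff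
      obtain ⟨i, hi, hle⟩ := h.2 (J ∪ J' \ {i₀})
        (union_subset hJ (hsub.trans sdiff_subset)) ⟨i₀, mem_union_left _ hi₀⟩
      have hinf : J'.inf (Function.update S i₀ (J.inf S)) = (J ∪ J' \ {i₀}).inf S := by
        conv_lhs => rw [← insert_erase hmem]
        rw [inf_insert, Function.update_self, hupd _ (notMem_erase _ _), inf_union, erase_eq]
      rw [sum_union hdisj] at hle
      have hsum : ∑ j ∈ J', Function.update d i₀ (∑ j ∈ J, d j) j =
          ∑ j ∈ J, d j + ∑ j ∈ J' \ {i₀}, d j := sum_update_of_mem hmem _ _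
      rw [hinf, hsum]
      rcases mem_union.1 hi with hi | hi
      · have := ht₀ i hi
        exact ⟨i₀, hmem, by omega⟩
      · exact ⟨i, (mem_sdiff.1 hi).1, hle⟩
    · have hsub : J' ⊆ s := fun i hi =>
        (mem_sdiff.1 ((mem_insert.1 (hJ' hi)).resolve_left fun h => hmem (h ▸ hi))).1
      obtain ⟨i, hi, hle⟩ := h.2 J' hsub hne
      refine ⟨i, hi, ?_⟩
      rwa [sum_update_of_notMem hmem, hupd _ hmem]

/-- Moving the point `j` to the special point preserves the Hall condition when there are no tight
proper subfamilies of size at least two. -/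
lemma HallCondition.merge (h : HallCondition s S t d m) {j : σ} {i₂ : ι} (hi₂ : i₂ ∈ s)
    (ht₂ : t i₂ = 0) (hj₂ : j ∉ S i₂)
    (hslack : ∀ J ⊆ s, J ≠ s → 2 ≤ #J → ∃ i ∈ J, ∑ j ∈ J, d j + #(J.inf S) + t i + 1 ≤ m) :
    HallCondition s (fun i => (S i).erase j) (fun i => t i + if j ∈ S i then 1 else 0) d m := by
  have hmem : ∀ i, #((S i).erase j) + (if j ∈ S i then 1 else 0) = #(S i) := fun i => by
    split_ifs with hj
    · exact card_erase_add_one hj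
    · rw [erase_eq_of_notMem hj, add_zero]
  have hcard : ∀ J : Finset ι, #(J.inf fun i => (S i).erase j) ≤ #(J.inf S) := fun J =>
    card_le_card (Finset.inf_mono_fun fun i _ => erase_subset _ _)
  refine ⟨fun i hi => ?_, fun J hJ hne => ?_⟩
  · have := h.1 i hi; have := hmem i; dsimp only; omega
  · have hc := hcard J
    by_cases hs : J = s
    · obtain ⟨i, hi, hle⟩ := h.2 J hJ hne
      -- The full family may have no slack, but `i₂` misses `j`, so its multiplicity stays `0`.
      refine ⟨i₂, hs ▸ hi₂, ?_⟩
      beta_reduce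
      rw [if_neg hj₂, ht₂]; omega
    · by_cases h2 : 2 ≤ #J
      · obtain ⟨i, hi, hle⟩ := hslack J hJ hs h2
        refine ⟨i, hi, ?_⟩
        beta_reduce
        split_ifs <;> omega
      · obtain ⟨i, rfl⟩ := card_eq_one.1 (le_antisymm (by omega) hne.card_pos)
        refine ⟨i, mem_singleton_self i, ?_⟩
        have := h.1 i (hJ (mem_singleton_self i)); have := hmem i
        rw [sum_singleton, inf_singleton]; beta_reduce; omega

/-- Equal patterns with `t = 0` have equal `d`, and the Hall condition on the pair would read `2d +
#S ≤ d + #S`. The difference of the two patterns supplies the point to be merged. -/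
lemma HallCondition.ne_of_zero [DecidableEq ι] (h : HallCondition s S t d m) {i₁ i₂ : ι}
    (hi₁ : i₁ ∈ s) (hi₂ : i₂ ∈ s) (hne : i₁ ≠ i₂) (ht₁ : t i₁ = 0) (ht₂ : t i₂ = 0)
    (hd₁ : 1 ≤ d i₁) : S i₁ ≠ S i₂ := by
  intro heq
  obtain ⟨i, -, hle⟩ := h.2 {i₁, i₂} (by simp [insert_subset_iff, hi₁, hi₂]) ⟨i₁, by simp⟩
  have h1 := h.1 i₁ hi₁
  have h2 := h.1 i₂ hi₂
  rw [sum_pair hne, inf_insert, inf_singleton, ← heq, inf_idem] at hle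
  rw [← heq] at h2
  omega

end Reductions

/-! ### The GM-MDS theorem. -/

/-- The algebraic GM-MDS theorem (Lovett, Yildiz–Hassibi), for generic points and one special
point of arbitrary multiplicity. -/
theorem exists_generic_syzygyFree {σ ι K : Type*} [Field K] [Infinite K] [Fintype σ]
    [DecidableEq σ] [DecidableEq ι] {s : Finset ι} {S : ι → Finset σ} {t d : ι → ℕ} {m : ℕ}
    (h : HallCondition s S t d m) :
    ∃ Q : MvPolynomial σ K, Q ≠ 0 ∧ ∀ a : σ → K, MvPolynomial.eval a Q ≠ 0 →
      SyzygyFree s S t d a := by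
  have exists_ne : ∀ Q : MvPolynomial σ K, Q ≠ 0 → ∃ a, MvPolynomial.eval a Q ≠ 0 := by
    intro Q hQ
    by_contra! hall
    exact hQ (MvPolynomial.funext fun a => by rw [hall a, map_zero])
  -- Discarding or contracting blocks lowers `#s`, dividing by `X` lowers `m`, and moving a point to
  -- `0` lowers `∑ #(S i)`.
  induction hN : #s + m + ∑ i ∈ s, #(S i) using Nat.strong_induction_on generalizing s S t d m with
  | _ N IH =>
  subst hN
  rcases s.eq_empty_or_nonempty with rfl | hs
  · exact ⟨1, one_ne_zero, fun a _ q _ _ i hi => absurd hi (notMem_empty i)⟩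
  by_cases hd : ∃ i ∈ s, d i = 0
  · obtain ⟨i, hi, hdi⟩ := hd
    obtain ⟨Q, hQ, hQ'⟩ := IH _ (by
      have := card_erase_lt_of_mem hi
      have := sum_le_sum_of_subset (f := fun i => #(S i)) (erase_subset i s)
      omega) (h.mono (erase_subset i s)) rfl
    exact ⟨Q, hQ, fun a ha => (hQ' a ha).of_erase hdi⟩
  have hd' : ∀ i ∈ s, 1 ≤ d i := fun i hi => Nat.one_le_iff_ne_zero.2 fun h0 => hd ⟨i, hi, h0⟩
  have hm : 1 ≤ m := by
    obtain ⟨i, hi⟩ := hs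
    have := h.1 i hi; have := hd' i hi; omega
  by_cases ht : ∃ i₁ ∈ s, t i₁ = 0
  swap
  · have ht' : ∀ i ∈ s, 1 ≤ t i := fun i hi => Nat.one_le_iff_ne_zero.2 fun h0 => ht ⟨i, hi, h0⟩
    obtain ⟨Q, hQ, hQ'⟩ := IH _ (by omega) (h.pred ht') rfl
    exact ⟨Q, hQ, fun a ha => (hQ' a ha).of_pred ht'⟩
  obtain ⟨i₁, hi₁, ht₁⟩ := ht
  by_cases ht : ∃ i₂ ∈ s, i₂ ≠ i₁ ∧ t i₂ = 0
  swap
  · have ht' : ∀ i ∈ s, i ≠ i₁ → 1 ≤ t i :=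
      fun i hi hne => Nat.one_le_iff_ne_zero.2 fun h0 => ht ⟨i, hi, hne, h0⟩
    obtain ⟨Q, hQ, hQ'⟩ := IH _ (by omega) (h.unique_zero hi₁ ht₁ (hd' i₁ hi₁) ht') rfl
    refine ⟨Q * ∏ j, MvPolynomial.X j,
      mul_ne_zero hQ (prod_ne_zero_iff.2 fun j _ => MvPolynomial.X_ne_zero j), fun a ha => ?_⟩
    rw [map_mul, map_prod, mul_ne_zero_iff, prod_ne_zero_iff] at ha
    exact (hQ' a ha.1).of_unique_zero hi₁ ht₁ (hd' i₁ hi₁) ht'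
      fun j => by simpa using ha.2 j (mem_univ j)
  obtain ⟨i₂, hi₂, hne, ht₂⟩ := ht
  by_cases hslack : ∀ J ⊆ s, J ≠ s → 2 ≤ #J →
      ∃ i ∈ J, ∑ j ∈ J, d j + #(J.inf S) + t i + 1 ≤ m
  swap
  · push Not at hslack
    obtain ⟨J, hJ, hJs, hcard, htight⟩ := hslack
    obtain ⟨i₀, hi₀, hle⟩ := h.2 J hJ (card_pos.1 (by omega))
    -- Failure of slack at every index of `J`, against the Hall inequality at `i₀`, makes `J` tight
    -- with `t i₀` minimal.
    have ht₀ : ∀ i ∈ J, t i₀ ≤ t i := fun i hi => by have := htight i hi; omega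
    have heq : ∑ j ∈ J, d j + #(J.inf S) + t i₀ = m := by have := htight i₀ hi₀; omega
    have hlt : #J < #s := card_lt_card (hJ.ssubset_of_ne hJs)
    have hnot : i₀ ∉ s \ J := by simp [hi₀]
    obtain ⟨Q₁, hQ₁, hQ₁'⟩ := IH _ (by
      have := sum_le_sum_of_subset (f := fun i => #(S i)) hJ
      omega) (h.mono hJ) rfl
    obtain ⟨Q₂, hQ₂, hQ₂'⟩ := IH _ (by
      have h1 : #(insert i₀ (s \ J)) < #s := by
        rw [card_insert_of_notMem hnot, card_sdiff_of_subset hJ]; omega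
      have h2 : ∑ i ∈ insert i₀ (s \ J), #(Function.update S i₀ (J.inf S) i) ≤
          ∑ i ∈ s, #(S i) := by
        calc _ ≤ ∑ i ∈ insert i₀ (s \ J), #(S i) := sum_le_sum fun i _ => by
              by_cases hi : i = i₀
              · subst hi; rw [Function.update_self]; exact card_le_card (Finset.inf_le hi₀)
              · rw [Function.update_of_ne hi]
          _ ≤ _ := sum_le_sum_of_subset (insert_subset (hJ hi₀) sdiff_subset)
      omega) (h.contract hJ hi₀ ht₀ heq) rfl
    refine ⟨Q₁ * Q₂, mul_ne_zero hQ₁ hQ₂, fun a ha => ?_⟩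
    rw [map_mul, mul_ne_zero_iff] at ha
    exact .of_contract hJ hi₀ ht₀ (fun i hi => by have := h.1 i (hJ hi); omega)
      (hQ₁' a ha.1) (hQ₂' a ha.2)
  have main : ∀ i₁ ∈ s, ∀ i₂ ∈ s, t i₂ = 0 → ∀ j ∈ S i₁, j ∉ S i₂ →
      ∃ Q : MvPolynomial σ K, Q ≠ 0 ∧ ∀ a : σ → K, MvPolynomial.eval a Q ≠ 0 →
        SyzygyFree s S t d a := by
    intro i₁ hi₁ i₂ hi₂ ht₂ j hj₁ hj₂
    obtain ⟨Q, hQ, hQ'⟩ := IH _ (by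
      have : ∑ i ∈ s, #((S i).erase j) < ∑ i ∈ s, #(S i) :=
        sum_lt_sum (fun i _ => card_le_card (erase_subset _ _)) ⟨i₁, hi₁, card_erase_lt_of_mem hj₁⟩
      omega) (h.merge hi₂ ht₂ hj₂ hslack) rfl
    obtain ⟨a, ha⟩ := exists_ne Q hQ
    -- Setting `a j = 0` turns the factor `X - a j` into `X`, which is the merged system.
    -- Independence at this one point then spreads to an open set.
    have hfree : SyzygyFree s S t d (Function.update a j 0) := by
      intro q hq hsum
      refine hQ' a ha q hq ?_
      rw [← hsum]
      refine sum_congr rfl fun i _ => ?_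
      congr 1
      have hc : ∀ t', nodalShift a ((S i).erase j) t' =
          nodalShift (Function.update a j 0) ((S i).erase j) t' := fun t' =>
        nodalShift_congr fun l hl => (Function.update_of_ne (ne_of_mem_erase hl) _ _).symm
      rw [hc]
      beta_reduce
      split_ifs with hj
      · rw [nodalShift_erase hj (Function.update_self _ _ _)]
      · rw [erase_eq_of_notMem hj, add_zero]
    obtain ⟨Q', hQ₀, hQ''⟩ := exists_polynomial_syzygyFree hfree
    exact ⟨Q', fun h0 => hQ₀ (by rw [h0, map_zero]), hQ''⟩
  have hSne := h.ne_of_zero hi₁ hi₂ hne.symm ht₁ ht₂ (hd' i₁ hi₁)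
  by_cases hsub : S i₁ ⊆ S i₂
  · obtain ⟨j, hj₂, hj₁⟩ := exists_of_ssubset (hsub.ssubset_of_ne hSne)
    exact main i₂ hi₂ i₁ hi₁ ht₁ j hj₂ hj₁
  · obtain ⟨j, hj₁, hj₂⟩ := not_subset.1 hsub
    exact main i₁ hi₁ i₂ hi₂ ht₂ j hj₁ hj₂

/-! ### The determinant attached to a tuple of error patterns, and its degree. -/

section PatternDeterminant

lemma totalDegree_coeff_nodalShift_le {σ R : Type*} [CommRing R] (S : Finset σ) (t r : ℕ) :
    ((nodalShift (MvPolynomial.X : σ → MvPolynomial σ R) S t).coeff r).totalDegree ≤ #S := by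
  classical
  rcases subsingleton_or_nontrivial R with _ | _
  · rw [Subsingleton.elim (coeff _ r) (0 : MvPolynomial σ R), MvPolynomial.totalDegree_zero]
    exact Nat.zero_le _
  induction S using Finset.induction_on generalizing t r with
  | empty =>
    simp only [nodalShift, prod_empty, mul_one, coeff_X_pow]
    split_ifs <;> simp
  | insert j S hj ih =>
    have hrec : nodalShift (MvPolynomial.X : σ → MvPolynomial σ R) (insert j S) t =
        nodalShift MvPolynomial.X S (t + 1) -
          C (MvPolynomial.X j : MvPolynomial σ R) * nodalShift MvPolynomial.X S t := by
      simp only [nodalShift, prod_insert hj]; ring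
    rw [hrec, coeff_sub, coeff_C_mul, card_insert_of_notMem hj]
    refine (MvPolynomial.totalDegree_sub _ _).trans (max_le ((ih _ _).trans (Nat.le_succ _)) ?_)
    refine (MvPolynomial.totalDegree_mul _ _).trans ?_
    rw [MvPolynomial.totalDegree_X, add_comm]
    exact Nat.add_le_add_right (ih _ _) 1

lemma totalDegree_det_le {σ β R : Type*} [CommRing R] [Fintype β] [DecidableEq β]
    (M : Matrix β β (MvPolynomial σ R)) (N : ℕ) (h : ∀ i j, (M i j).totalDegree ≤ N) :
    M.det.totalDegree ≤ Fintype.card β * N := by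
  rw [Matrix.det_apply]
  refine MvPolynomial.totalDegree_finsetSum_le fun τ _ => ?_
  refine (MvPolynomial.totalDegree_smul_le _ _).trans ?_
  refine (MvPolynomial.totalDegree_finsetProd _ _).trans ?_
  exact (sum_le_card_nsmul _ _ N fun i _ => h _ _).trans (by simp)

variable {σ ι F : Type*} [Field F] [Fintype σ] [DecidableEq σ] [DecidableEq ι]

/-- When the blocks have total dimension `m`, they span the polynomials of degree `< m` outside the
zero set of a nonzero polynomial of degree at most `m ^ 2`. -/
theorem exists_spanning_polynomial {s : Finset ι} {S : ι → Finset σ} {t d : ι → ℕ} {m : ℕ}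
    (h : HallCondition s S t d m) (hd : ∑ i ∈ s, d i = m) :
    ∃ D : MvPolynomial σ F, D ≠ 0 ∧ D.totalDegree ≤ m * m ∧
      ∀ α : σ → F, MvPolynomial.eval α D ≠ 0 → ∀ φ : Fin m → F,
        (∀ i ∈ s, ∀ l < d i, ∑ r, φ r * (nodalShift α (S i) (t i + l)).coeff r = 0) → φ = 0 := by
  let β := (s.sigma fun i => range (d i) : Finset (Σ _ : ι, ℕ))
  have hβ : Fintype.card (Fin m) = Fintype.card β := by
    rw [Fintype.card_fin, Fintype.card_coe, card_sigma]; simp [hd]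
  let e : Fin m ≃ β := Fintype.equivOfCardEq hβ
  have hS : ∀ b : β, #(S b.1.1) ≤ m := fun b => by
    have := h.1 _ (mem_sigma.1 b.2).1; omega
  let M : Matrix (Fin m) (Fin m) (MvPolynomial σ F) := Matrix.of fun r c =>
    (nodalShift MvPolynomial.X (S (e c).1.1) (t (e c).1.1 + (e c).1.2)).coeff r
  refine ⟨M.det, fun h0 => ?_, ?_, fun α hα φ hφ => ?_⟩
  -- `F` may be finite, so a generic point is taken in the algebraic closure; a zero determinant
  -- would vanish there too.
  · let K := AlgebraicClosure F
    obtain ⟨Q, hQ, hQ'⟩ := exists_generic_syzygyFree (K := K) h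
    obtain ⟨a, ha⟩ : ∃ a, MvPolynomial.eval a Q ≠ 0 := by
      by_contra! hall
      exact hQ (MvPolynomial.funext fun a => by rw [hall a, map_zero])
    have hind := (syzygyFree_iff_linearIndepOn s S t d a).1 (hQ' a ha)
    have hind' : LinearIndependent K fun c : Fin m =>
        nodalShift a (S (e c).1.1) (t (e c).1.1 + (e c).1.2) :=
      LinearIndependent.comp hind e e.injective
    rw [Fintype.linearIndependent_iff] at hind'
    have hdet := congrArg (MvPolynomial.eval₂Hom (algebraMap F K) a) h0
    rw [RingHom.map_det, map_zero] at hdet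
    obtain ⟨v, hv, hMv⟩ := Matrix.exists_mulVec_eq_zero_iff.2 hdet
    refine hv (funext fun c => hind' v ?_ c)
    refine Polynomial.ext fun r => ?_
    rw [finsetSum_coeff, coeff_zero]
    by_cases hr : r < m
    · have := congrFun hMv ⟨r, hr⟩
      simp only [Matrix.mulVec, dotProduct, Pi.zero_apply] at this
      rw [← this]
      refine sum_congr rfl fun c _ => ?_
      rw [coeff_smul, smul_eq_mul, mul_comm]
      congr 1
      have hmap := nodalShift_map (MvPolynomial.eval₂Hom (algebraMap F K) a)
        MvPolynomial.X (S (e c).1.1) (t (e c).1.1 + (e c).1.2)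
      simp only [MvPolynomial.eval₂Hom_X'] at hmap
      rw [← hmap, coeff_map]
      rfl
    · refine sum_eq_zero fun c _ => ?_
      rw [coeff_smul, coeff_eq_zero_of_natDegree_lt, smul_zero]
      rw [nodalShift_natDegree]
      obtain ⟨h1, h2⟩ := mem_sigma.1 (e c).2
      have := h.1 _ h1
      have := mem_range.1 h2
      omega
  · refine (totalDegree_det_le M m fun r c => ?_).trans_eq (by rw [Fintype.card_fin])
    exact (totalDegree_coeff_nodalShift_le _ _ _).trans (hS (e c))
  · rw [RingHom.map_det] at hα
    refine Matrix.eq_zero_of_vecMul_eq_zero hα (funext fun c => ?_)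
    obtain ⟨h1, h2⟩ := mem_sigma.1 (e c).2
    rw [Pi.zero_apply, ← hφ _ h1 _ (mem_range.1 h2), Matrix.vecMul, dotProduct]
    refine sum_congr rfl fun r _ => congrArg _ ?_
    have hmap := nodalShift_map (MvPolynomial.eval α)
      MvPolynomial.X (S (e c).1.1) (t (e c).1.1 + (e c).1.2)
    simp only [MvPolynomial.eval_X] at hmap
    rw [← hmap, coeff_map]
    rfl

end PatternDeterminant

/-! ### Trimming blocks to a tight Hall system. -/

lemma exists_le_sum_eq {ι : Type*} [DecidableEq ι] (s : Finset ι) (f : ι → ℕ) (c : ℕ)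
    (hc : c ≤ ∑ i ∈ s, f i) : ∃ d : ι → ℕ, (∀ i, d i ≤ f i) ∧ ∑ i ∈ s, d i = c := by
  induction s using Finset.induction_on generalizing c with
  | empty => exact ⟨0, fun i => Nat.zero_le _, by simpa using hc.antisymm (Nat.zero_le _) |>.symm⟩
  | insert j s hj ih =>
    rw [sum_insert hj] at hc
    obtain ⟨d, hd, hsum⟩ := ih (c - f j) (by omega)
    refine ⟨Function.update d j (min c (f j)), fun i => ?_, ?_⟩
    · by_cases hi : i = j
      · subst hi; simp
      · rw [Function.update_of_ne hi]; exact hd i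
    · rw [sum_insert hj, Function.update_self, sum_update_of_notMem hj, hsum]; omega

/-- Error patterns of large total dimension can be completed to a tight system satisfying the Hall
condition. -/
lemma exists_hallCondition {σ ι : Type*} [Fintype σ] [DecidableEq σ] [Fintype ι] [DecidableEq ι]
    [Nonempty ι] {E : ι → Finset σ} {m : ℕ} (hcard : ∀ i, #(E i) ≤ m)
    (hproper : ∀ J : Finset ι, J ≠ univ → 2 ≤ #J → ∑ i ∈ J, (m - #(E i)) + #(J.inf E) ≤ m)
    (hinter : univ.inf E = ∅) (htot : m ≤ ∑ i, (m - #(E i))) :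
    ∃ t d : ι → ℕ, HallCondition univ E t d m ∧ ∑ i, d i = m := by
  obtain ⟨i₀⟩ := ‹Nonempty ι›
  rw [← add_sum_erase univ _ (mem_univ i₀)] at htot
  -- The block of `i₀` keeps its full dimension `m - #(E i₀)`, so the others supply exactly `#(E
  -- i₀)`. Hence `t i₀ = 0`, as the whole family, of total dimension `m`, requires.
  obtain ⟨d, hd, hsum⟩ := exists_le_sum_eq (univ.erase i₀) (fun i => m - #(E i)) #(E i₀)
    (by have := hcard i₀; omega)
  let d' := Function.update d i₀ (m - #(E i₀))
  have hd' : ∀ i, d' i ≤ m - #(E i) := fun i => by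
    by_cases hi : i = i₀
    · subst hi; simp [d']
    · simpa [d', Function.update_of_ne hi] using hd i
  have hsum' : ∑ i, d' i = m := by
    rw [sum_update_of_mem (mem_univ _), ← erase_eq, hsum]
    have := hcard i₀; omega
  have hkey : ∀ i, #(E i) + (m - #(E i) - d' i) + d' i = m := fun i => by
    have := hcard i; have := hd' i; omega
  refine ⟨fun i => m - #(E i) - d' i, d', ⟨fun i _ => hkey i, fun J _ hne => ?_⟩, hsum'⟩
  by_cases hJ : J = univ
  · subst hJ
    refine ⟨i₀, mem_univ _, ?_⟩
    rw [hsum', hinter]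
    simp [d']
  · obtain ⟨i, hi⟩ := hne
    refine ⟨i, hi, ?_⟩
    beta_reduce
    by_cases h2 : 2 ≤ #J
    · have h1 := hproper J hJ h2
      -- Trimming trades dimension for multiplicity: `d' i + t i = m - #(E i)`, so any `i ∈ J` is a
      -- witness.
      have h3 : ∑ j ∈ J.erase i, d' j ≤ ∑ j ∈ J.erase i, (m - #(E j)) :=
        sum_le_sum fun j _ => hd' j
      rw [← add_sum_erase J _ hi] at h1 ⊢
      have := hd' i
      omega
    · obtain ⟨j, rfl⟩ := card_eq_one.1 (le_antisymm (by omega) (card_pos.2 ⟨i, hi⟩))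
      obtain rfl := mem_singleton.1 hi
      rw [sum_singleton, inf_singleton]
      have := hkey i; omega

/-! ### Duality for Reed–Solomon codes. -/

section ReedSolomon

variable {F : Type*} [Field F] {n k : ℕ}

/-- The column multipliers of the generalized Reed–Solomon code dual to the code of `α`. -/
noncomputable def dualMultiplier (α : Fin n → F) (j : Fin n) : F :=
  (∏ i ∈ univ.erase j, (α j - α i))⁻¹

lemma dualMultiplier_ne_zero {α : Fin n → F} (hα : Function.Injective α) (j : Fin n) :
    dualMultiplier α j ≠ 0 :=
  inv_ne_zero (prod_ne_zero_iff.2 fun _ hi => sub_ne_zero.2 (hα.ne (ne_of_mem_erase hi).symm))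

/-- The sum is the coefficient of `X ^ (n - 1)` in the Lagrange interpolation of `p`. -/
lemma sum_dualMultiplier_mul_eval {α : Fin n → F} (hα : Function.Injective α) {p : F[X]}
    (hp : p.natDegree + 1 < n) : ∑ j, dualMultiplier α j * p.eval (α j) = 0 := by
  have h := Lagrange.coeff_eq_sum (s := univ) (v := α) hα.injOn (P := p) (by
    rw [card_fin]
    exact degree_le_natDegree.trans_lt (by exact_mod_cast (by omega : p.natDegree < n)))
  rw [card_fin, coeff_eq_zero_of_natDegree_lt (by omega)] at h
  rw [h]
  exact sum_congr rfl fun j _ => by rw [dualMultiplier, div_eq_inv_mul]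

/-- A generator is the evaluation of `X ^ r` with `r < k`, and `X ^ r * g` has degree at most `n -
2`. -/
lemma sum_dualMultiplier_mul_codeword {α : Fin n → F} (hα : Function.Injective α) {c : Fin n → F}
    (hc : c ∈ reedSolomonCode k α) {g : F[X]} (hg : g.degree < ((n - k : ℕ) : WithBot ℕ)) :
    ∑ j, dualMultiplier α j * c j * g.eval (α j) = 0 := by
  by_cases hg0 : g = 0
  · simp [hg0]
  rw [degree_eq_natDegree hg0] at hg
  have hg' : g.natDegree < n - k := by exact_mod_cast hg
  induction hc using Submodule.span_induction with
  | mem x hx =>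
    obtain ⟨r, rfl⟩ := hx
    rw [← sum_dualMultiplier_mul_eval hα (p := X ^ (r : ℕ) * g) (by
      have := r.2
      rw [natDegree_X_pow_mul _ hg0]; omega)]
    refine sum_congr rfl fun j _ => ?_
    simp [vandermondeGenerator, Matrix.row, mul_assoc]
  | zero => simp
  | add x y _ _ hx hy => simp only [Pi.add_apply, mul_add, add_mul, sum_add_distrib, hx, hy, add_zero]
  | smul a x _ hx =>
    rw [← mul_zero a, ← hx, mul_sum]
    exact sum_congr rfl fun j _ => by rw [Pi.smul_apply, smul_eq_mul]; ring

lemma finrank_reedSolomonCode {α : Fin n → F} (hα : Function.Injective α) (hkn : k ≤ n) :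
    Module.finrank F (reedSolomonCode k α) = k := by
  have hli : LinearIndependent F (vandermondeGenerator k α).row := by
    rw [Fintype.linearIndependent_iff]
    intro g hg
    let p : F[X] := ∑ r : Fin k, C (g r) * X ^ (r : ℕ)
    have hp : p = 0 := by
      refine eq_zero_of_degree_lt_of_eval_index_eq_zero univ (v := α) hα.injOn ?_ fun j _ => ?_
      · refine (degree_sum_le _ _).trans_lt ((Finset.sup_lt_iff (WithBot.bot_lt_coe _)).2 ?_)
        intro r _
        refine (degree_C_mul_X_pow_le _ _).trans_lt ?_
        rw [card_fin]
        exact_mod_cast r.2.trans_le hkn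
      · have := congrFun hg j
        simpa [p, eval_finsetSum, vandermondeGenerator, Matrix.row] using this
    intro r
    have := congrArg (fun q => coeff q r) hp
    simpa [p, finsetSum_coeff, coeff_C_mul, coeff_X_pow, Fin.val_inj] using this
  rw [reedSolomonCode, finrank_span_eq_card hli, Fintype.card_fin]

/-- A word pairing to zero with all polynomials of degree `< m` and supported on at most `m`
coordinates vanishes. -/
lemma eq_zero_of_dual_of_support {α : Fin n → F} (hα : Function.Injective α) {m : ℕ}
    {x : Fin n → F} {E : Finset (Fin n)} (hE : #E ≤ m) (hx : ∀ j ∉ E, x j = 0)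
    (h : ∀ g : F[X], g.degree < (m : WithBot ℕ) →
      ∑ j, dualMultiplier α j * x j * g.eval (α j) = 0) : x = 0 := by
  funext j
  by_cases hj : j ∈ E
  · have h1 := h (Lagrange.basis E α j) (by
      rw [Lagrange.degree_basis hα.injOn hj]
      have := card_pos.2 ⟨j, hj⟩
      exact_mod_cast (by omega : #E - 1 < m))
    rw [sum_eq_single j, Lagrange.eval_basis_self hα.injOn hj, mul_one] at h1
    · exact (mul_eq_zero.1 h1).resolve_left (dualMultiplier_ne_zero hα j)
    · intro i _ hij
      by_cases hi : i ∈ E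
      · rw [Lagrange.eval_basis_of_ne hij.symm hi, mul_zero]
      · rw [hx i hi, mul_zero, zero_mul]
    · simp
  · exact hx j hj

/-- If the blocks attached to the error patterns span, all codewords coincide with the received
word. -/
lemma codeword_eq_of_spanning {ι : Type*} {α : Fin n → F} (hα : Function.Injective α)
    {c : ι → Fin n → F} (hc : ∀ i, c i ∈ reedSolomonCode k α) {y : Fin n → F}
    {E : ι → Finset (Fin n)} {t d : ι → ℕ} (hE : ∀ i, ∀ j ∉ E i, c i j = y j)
    (hd : ∀ i, #(E i) + t i + d i = n - k)
    (hspan : ∀ φ : Fin (n - k) → F,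
      (∀ i, ∀ l < d i, ∑ r, φ r * (nodalShift α (E i) (t i + l)).coeff r = 0) → φ = 0) (i : ι) :
    c i = y := by
  let φ : Fin (n - k) → F := fun r => ∑ j, dualMultiplier α j * y j * α j ^ (r : ℕ)
  have hφg : ∀ g : F[X], g.degree < ((n - k : ℕ) : WithBot ℕ) →
      ∑ r, φ r * g.coeff r = ∑ j, dualMultiplier α j * y j * g.eval (α j) := by
    intro g hg
    simp only [φ, sum_mul]
    rw [sum_comm]
    refine sum_congr rfl fun j _ => ?_
    conv_rhs => rw [eq_sum_range_of_degree_lt hg, eval_finsetSum, mul_sum, sum_range]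
    refine sum_congr rfl fun r _ => ?_
    simp only [eval_mul, eval_C, eval_pow, eval_X]; ring
  -- Codewords have zero syndrome, so `c i - y` and `-y` pair alike with `g`.
  have hdiff : ∀ i, ∀ g : F[X], g.degree < ((n - k : ℕ) : WithBot ℕ) →
      ∑ j, dualMultiplier α j * (c i - y) j * g.eval (α j) =
        -∑ j, dualMultiplier α j * y j * g.eval (α j) := by
    intro i g hg
    rw [← zero_sub, ← sum_dualMultiplier_mul_codeword hα (hc i) hg, ← sum_sub_distrib]
    exact sum_congr rfl fun j _ => by rw [Pi.sub_apply]; ring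
  have hφ : φ = 0 := hspan φ fun i l hl => by
    have hdeg : (nodalShift α (E i) (t i + l)).degree < ((n - k : ℕ) : WithBot ℕ) := by
      rw [degree_eq_natDegree (nodalShift_monic _ _ _).ne_zero, nodalShift_natDegree]
      have := hd i
      exact_mod_cast (by omega : #(E i) + (t i + l) < n - k)
    rw [hφg _ hdeg, ← neg_eq_zero, ← hdiff i _ hdeg]
    refine sum_eq_zero fun j _ => ?_
    by_cases hj : j ∈ E i
    · simp [nodalShift, eval_prod, prod_eq_zero hj]
    · simp [hE i j hj]
  refine sub_eq_zero.1 (eq_zero_of_dual_of_support hα (E := E i) (m := n - k)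
    (by have := hd i; omega) (fun j hj => by simp [hE i j hj]) fun g hg => ?_)
  rw [hdiff i g hg, ← hφg g hg, hφ]
  simp

end ReedSolomon

/-! ### Minimal violations. -/

section MinimalConfiguration

variable {F : Type*} [Field F] [DecidableEq F] {n : ℕ}

/-- Changing the received word on the coordinates that are in error for every codeword of `J`. -/
lemma exists_correction {J : Finset (Fin n → F)} (hJ : J.Nonempty) (y : Fin n → F) :
    ∃ y' : Fin n → F, (∀ j, ∃ c ∈ J, c j = y' j) ∧
      ∑ c ∈ J, hammingNorm (c - y') + #{j | ∀ c ∈ J, c j ≠ y j} ≤ ∑ c ∈ J, hammingNorm (c - y) := by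
  obtain ⟨c₀, hc₀⟩ := hJ
  -- Where all of `J` is wrong, `y'` copies `c₀`: each such coordinate removes an error of `c₀`, and
  -- no new error arises.
  let y' : Fin n → F := fun j => if ∃ c ∈ J, c j = y j then y j else c₀ j
  have hsub : ∀ c ∈ J, ∀ j, c j ≠ y' j → c j ≠ y j := by
    intro c hc j hne heq
    exact hne (by simp only [y', if_pos (⟨c, hc, heq⟩ : ∃ c ∈ J, c j = y j)]; exact heq)
  refine ⟨y', fun j => ?_, ?_⟩
  · by_cases h : ∃ c ∈ J, c j = y j
    · simpa only [y', if_pos h] using h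
    · exact ⟨c₀, hc₀, by simp only [y', if_neg h]⟩
  · rw [← add_sum_erase J _ hc₀, ← add_sum_erase J _ hc₀, add_right_comm]
    refine Nat.add_le_add ?_ (sum_le_sum fun c hc => ?_)
    · rw [hammingNorm, hammingNorm, ← card_union_of_disjoint]
      · refine card_le_card fun j hj => ?_
        simp only [mem_union, mem_filter, mem_univ, true_and, Pi.sub_apply, ne_eq, sub_eq_zero] at hj ⊢
        exact hj.elim (hsub c₀ hc₀ j) fun h => h c₀ hc₀
      · rw [disjoint_left]
        intro j h1 h2
        simp only [mem_filter, mem_univ, true_and, Pi.sub_apply, ne_eq, sub_eq_zero] at h1 h2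
        refine h1 ?_
        simp only [y']
        rw [if_neg]
        rintro ⟨c, hc, heq⟩
        exact h2 c hc heq
    · refine card_le_card fun j hj => ?_
      simp only [mem_filter, mem_univ, true_and, Pi.sub_apply, ne_eq, sub_eq_zero] at hj ⊢
      exact hsub c (mem_of_mem_erase hc) j hj

/-- A violation of average-radius list decodability contains one that is minimal: no coordinate
is in error for every codeword, and no proper subfamily gives a violation after correction. -/
lemma exists_minimal_violation {m : ℕ} {T₀ : Finset (Fin n → F)} {y₀ : Fin n → F} (h2 : 2 ≤ #T₀)
    (h : ∑ c ∈ T₀, hammingNorm (c - y₀) ≤ (#T₀ - 1) * m) :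
    ∃ T ⊆ T₀, ∃ y : Fin n → F, 2 ≤ #T ∧ ∑ c ∈ T, hammingNorm (c - y) ≤ (#T - 1) * m ∧
      (∀ j, ∃ c ∈ T, c j = y j) ∧ ∀ J ⊆ T, J ≠ T → 2 ≤ #J →
        (#J - 1) * m + #{j | ∀ c ∈ J, c j ≠ y j} < ∑ c ∈ J, hammingNorm (c - y) := by
  induction hN : #T₀ using Nat.strong_induction_on generalizing T₀ y₀ with
  | _ N IH =>
  subst hN
  obtain ⟨y, hy, hle⟩ := exists_correction (J := T₀) (card_pos.1 (by omega)) y₀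
  by_cases hmin : ∀ J ⊆ T₀, J ≠ T₀ → 2 ≤ #J →
      (#J - 1) * m + #{j | ∀ c ∈ J, c j ≠ y j} < ∑ c ∈ J, hammingNorm (c - y)
  · exact ⟨T₀, Subset.rfl, y, h2, (Nat.le_add_right _ _).trans (hle.trans h), hy, hmin⟩
  · push Not at hmin
    obtain ⟨J, hJ, hne, hJ2, hJle⟩ := hmin
    -- Correction saves at least the number of common errors, so `J` with `y'` is a smaller
    -- violation.
    obtain ⟨y', -, hle'⟩ := exists_correction (J := J) (card_pos.1 (by omega)) y
    obtain ⟨T, hT, h'⟩ := IH _ (card_lt_card (hJ.ssubset_of_ne hne)) hJ2 (y₀ := y') (by omega) rfl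
    exact ⟨T, hT.trans hJ, h'⟩

end MinimalConfiguration

/-! ### From spanning blocks to list decodability. -/

section Code

variable {F : Type*} [Field F] [DecidableEq F] {n k : ℕ}

/-- Codewords violating average-radius list decodability give error patterns whose blocks cannot
span. -/
theorem lt_sum_hammingNorm_of_spanning {α : Fin n → F} (hα : Function.Injective α) {L : ℕ}
    (hspan : ∀ ℓ ∈ Icc 1 L, ∀ E : Fin (ℓ + 1) → Finset (Fin n), (∀ i, #(E i) ≤ n - k) →
      (∃ t d : Fin (ℓ + 1) → ℕ, HallCondition univ E t d (n - k) ∧ ∑ i, d i = n - k) →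
      ∃ t d : Fin (ℓ + 1) → ℕ, (∀ i, #(E i) + t i + d i = n - k) ∧ ∀ φ : Fin (n - k) → F,
        (∀ i, ∀ l < d i, ∑ r, φ r * (nodalShift α (E i) (t i + l)).coeff r = 0) → φ = 0)
    {T₀ : Finset (Fin n → F)} (hT₀ : ∀ c ∈ T₀, c ∈ reedSolomonCode k α) (h2 : 2 ≤ #T₀)
    (hL : #T₀ ≤ L + 1) (y₀ : Fin n → F) :
    (#T₀ - 1) * (n - k) < ∑ c ∈ T₀, hammingNorm (c - y₀) := by
  by_contra! hle
  obtain ⟨T, hT, y, hT2, hsum, hcover, hmin⟩ := exists_minimal_violation h2 hle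
  have hTL := (card_le_card hT).trans hL
  obtain ⟨ℓ, hℓ⟩ : ∃ ℓ, #T = ℓ + 1 := ⟨#T - 1, by omega⟩
  let e := (T.equivFinOfCardEq hℓ).symm
  let c : Fin (ℓ + 1) → Fin n → F := fun i => (e i).1
  have hcT : ∀ i, c i ∈ T := fun i => (e i).2
  have hcinj : Function.Injective c := Subtype.val_injective.comp e.injective
  have himage : univ.image c = T := by
    refine eq_of_subset_of_card_le (image_subset_iff.2 fun i _ => hcT i) ?_
    rw [card_image_of_injective _ hcinj, card_fin, hℓ]
  let E : Fin (ℓ + 1) → Finset (Fin n) := fun i => {j | c i j ≠ y j}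
  have hE : ∀ i, hammingNorm (c i - y) = #(E i) := fun i => by
    simp only [hammingNorm, E, Pi.sub_apply, ne_eq, sub_eq_zero]
  have hsumE : ∀ J : Finset (Fin (ℓ + 1)),
      ∑ x ∈ J.image c, hammingNorm (x - y) = ∑ i ∈ J, #(E i) := fun J => by
    rw [sum_image fun _ _ _ _ h => hcinj h]
    exact sum_congr rfl fun i _ => hE i
  have htot : ∑ i, #(E i) ≤ ℓ * (n - k) := by
    rw [← hsumE, himage]
    simpa [hℓ] using hsum
  have hmin' : ∀ J : Finset (Fin (ℓ + 1)), J ≠ univ → 2 ≤ #J →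
      (#J - 1) * (n - k) + #(J.inf E) < ∑ i ∈ J, #(E i) := by
    intro J hJ hJ2
    have hcard : #(J.image c) = #J := card_image_of_injective _ hcinj
    have h1 := hmin (J.image c) (image_subset_iff.2 fun i _ => hcT i) (fun h => hJ (by
      rw [← himage] at h
      exact image_injective hcinj h)) (by omega)
    rw [hcard, hsumE] at h1
    convert h1 using 3
    ext j
    simp [Finset.mem_inf, E]
  -- The total is at most `ℓ * (n - k)`, while by minimality the other patterns already exceed `(ℓ -
  -- 1) * (n - k)`. For `ℓ = 1` the total bound alone suffices.
  have hcardE : ∀ i, #(E i) ≤ n - k := by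
    intro i
    rw [← add_sum_erase univ _ (mem_univ i)] at htot
    have hc1 : #(univ.erase i) = ℓ := by rw [card_erase_of_mem (mem_univ i)]; simp
    by_cases h : 2 ≤ ℓ
    · have h1 := hmin' (univ.erase i) (erase_ne_self.2 (mem_univ i)) (by omega)
      rw [hc1] at h1
      obtain ⟨p, rfl⟩ : ∃ p, ℓ = p + 1 := ⟨ℓ - 1, by omega⟩
      rw [Nat.add_sub_cancel] at h1
      rw [add_mul] at htot
      omega
    · obtain rfl : ℓ = 1 := by omega
      omega
  have hcompl : ∀ J : Finset (Fin (ℓ + 1)),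
      ∑ i ∈ J, (n - k - #(E i)) + ∑ i ∈ J, #(E i) = #J * (n - k) := fun J => by
    rw [← sum_add_distrib, sum_congr rfl fun i _ => Nat.sub_add_cancel (hcardE i), sum_const,
      smul_eq_mul]
  have hadm : ∃ t d : Fin (ℓ + 1) → ℕ,
      HallCondition univ E t d (n - k) ∧ ∑ i, d i = n - k := by
    refine exists_hallCondition hcardE (fun J hJ hJ2 => ?_) ?_ ?_
    · have h1 := hmin' J hJ hJ2
      have h3 := hcompl J
      obtain ⟨p, hp⟩ : ∃ p, #J = p + 1 := ⟨#J - 1, by omega⟩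
      rw [hp, Nat.add_sub_cancel] at h1
      rw [hp, add_mul] at h3
      omega
    · refine eq_empty_of_forall_notMem fun j hj => ?_
      obtain ⟨x, hx, hxj⟩ := hcover j
      rw [← himage, mem_image] at hx
      obtain ⟨i, -, rfl⟩ := hx
      have := Finset.mem_inf.1 hj i (mem_univ i)
      simp [E, hxj] at this
    · have h3 := hcompl univ
      rw [card_fin, add_mul] at h3
      omega
  obtain ⟨t, d, hd, hφ⟩ := hspan ℓ (mem_Icc.2 (by omega)) E hcardE hadm
  have heq := codeword_eq_of_spanning hα (fun i => hT₀ _ (hT (hcT i))) (y := y) (E := E)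
    (fun i j hj => by simpa [E] using hj) hd hφ
  obtain ⟨p, rfl⟩ : ∃ p, ℓ = p + 1 := ⟨ℓ - 1, by omega⟩
  exact Fin.zero_ne_one (hcinj ((heq 0).trans (heq 1).symm))

lemma isAvgRadiusListDecodable_of_lt {C : Submodule F (Fin n → F)} {ℓ : ℕ} (hn : 0 < n)
    (hkn : k ≤ n)
    (h : ∀ T : Finset (Fin n → F), (∀ c ∈ T, c ∈ C) → #T = ℓ + 1 → ∀ y : Fin n → F,
      ℓ * (n - k) < ∑ c ∈ T, hammingNorm (c - y)) :
    IsAvgRadiusListDecodable C ((ℓ : ℝ) / ((ℓ : ℝ) + 1) * (1 - (k : ℝ) / n)) ℓ := by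
  rintro ⟨c, y, hinj, hc, hle⟩
  have hlt := h (univ.image c) (by simpa using hc)
    (by rw [card_image_of_injective _ hinj, card_fin]) y
  rw [sum_image fun _ _ _ _ h => hinj h] at hlt
  have hlt' : (ℓ : ℝ) * (n - k) < ∑ i, (hammingNorm (c i - y) : ℝ) := by
    have := (Nat.cast_lt (α := ℝ)).2 hlt
    push_cast [Nat.cast_sub hkn] at this
    exact this
  have hn' : (0 : ℝ) < n := by exact_mod_cast hn
  have hℓ : (0 : ℝ) < (ℓ : ℝ) + 1 := by positivity
  have hr : (ℓ : ℝ) / ((ℓ : ℝ) + 1) * (1 - (k : ℝ) / n) * n = ℓ * (n - k) / (ℓ + 1) := by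
    field_simp
  rw [hr, one_div_mul_eq_div, div_le_div_iff_of_pos_right hℓ] at hle
  linarith

/-- Any `ℓ + 1` words in a ball have average distance at most its radius. -/
lemma IsAvgRadiusListDecodable.isListDecodable {C : Submodule F (Fin n → F)} {ρ : ℝ} {ℓ : ℕ}
    (h : IsAvgRadiusListDecodable C ρ ℓ) : IsListDecodable C ρ ℓ := by
  intro y
  by_contra! hlt
  obtain ⟨T, hT, hcard⟩ := Set.exists_subset_encard_eq (Order.add_one_le_of_lt hlt)
  have hfin : T.Finite := Set.finite_of_encard_eq_coe (k := ℓ + 1) (by rw [hcard]; norm_cast)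
  have hcard' : #hfin.toFinset = ℓ + 1 := by
    rw [hfin.encard_eq_coe_toFinset_card] at hcard
    exact_mod_cast hcard
  let e := (hfin.toFinset.equivFinOfCardEq hcard').symm
  have he : ∀ i, (e i).1 ∈ C ∧ (hammingNorm ((e i).1 - y) : ℝ) ≤ ρ * n :=
    fun i => hT (hfin.mem_toFinset.1 (e i).2)
  refine h ⟨fun i => (e i).1, y, Subtype.val_injective.comp e.injective, fun i => (he i).1, ?_⟩
  have hsum : ∑ i, (hammingNorm ((e i).1 - y) : ℝ) ≤ (ℓ + 1) * (ρ * n) := by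
    refine (sum_le_card_nsmul _ _ _ fun i _ => (he i).2).trans_eq ?_
    simp
  have hℓ : (0 : ℝ) < (ℓ : ℝ) + 1 := by positivity
  rw [one_div_mul_eq_div, div_le_iff₀ hℓ]
  linarith

end Code

/-! ### Counting patterns, Schwartz–Zippel and the conclusion. -/

lemma card_filter_card_le (n m : ℕ) :
    #{S : Finset (Fin n) | #S ≤ m} = chooseLE n m := by
  rw [chooseLE, card_eq_sum_card_fiberwise (f := fun S : Finset (Fin n) => #S)
    (t := Finset.range (m + 1)) (fun S hS => by
      simp only [coe_filter, mem_univ, true_and, Set.mem_ofPred_eq] at hS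
      simpa using Nat.lt_succ_of_le hS)]
  refine sum_congr rfl fun i hi => ?_
  have : ({S ∈ ({S : Finset (Fin n) | #S ≤ m} : Finset (Finset (Fin n))) | #S = i}) =
      powersetCard i univ := by
    ext S
    have := mem_range.1 hi
    simp only [mem_filter, mem_univ, true_and, mem_powersetCard, subset_univ]
    omega
  rw [this, card_powersetCard, card_fin]

/-- All bad evaluation points lie in the zero set of a single nonzero polynomial. -/
theorem exists_polynomial_good (n k L : ℕ) (hL : 0 < L) (F : Type*) [Field F] :
    ∃ P : MvPolynomial (Fin n) F, P ≠ 0 ∧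
      P.totalDegree ≤ 2 * L * n ^ 2 * chooseLE n (n - k) ^ (L + 1) ∧
      ∀ α : Fin n → F, MvPolynomial.eval α P ≠ 0 → Function.Injective α ∧
        ∀ ℓ ∈ Icc 1 L, ∀ E : Fin (ℓ + 1) → Finset (Fin n), (∀ i, #(E i) ≤ n - k) →
          (∃ t d : Fin (ℓ + 1) → ℕ, HallCondition univ E t d (n - k) ∧ ∑ i, d i = n - k) →
          ∃ t d : Fin (ℓ + 1) → ℕ, (∀ i, #(E i) + t i + d i = n - k) ∧ ∀ φ : Fin (n - k) → F,
            (∀ i, ∀ l < d i, ∑ r, φ r * (nodalShift α (E i) (t i + l)).coeff r = 0) → φ = 0 := by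
  -- One admissible `(t, d)` is fixed per `E`, and the constant `1` serves when there is none, so
  -- the degree count ranges over pattern tuples only.
  have key : ∀ (ℓ : ℕ) (E : Fin (ℓ + 1) → Finset (Fin n)), ∃ D : MvPolynomial (Fin n) F,
      D ≠ 0 ∧ D.totalDegree ≤ n ^ 2 ∧ ∀ α : Fin n → F, MvPolynomial.eval α D ≠ 0 →
        (∃ t d : Fin (ℓ + 1) → ℕ, HallCondition univ E t d (n - k) ∧ ∑ i, d i = n - k) →
        ∃ t d : Fin (ℓ + 1) → ℕ, (∀ i, #(E i) + t i + d i = n - k) ∧ ∀ φ : Fin (n - k) → F,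
          (∀ i, ∀ l < d i, ∑ r, φ r * (nodalShift α (E i) (t i + l)).coeff r = 0) → φ = 0 := by
    intro ℓ E
    by_cases h : ∃ t d : Fin (ℓ + 1) → ℕ, HallCondition univ E t d (n - k) ∧ ∑ i, d i = n - k
    · obtain ⟨t, d, hH, hd⟩ := h
      obtain ⟨D, hD, hdeg, hspan⟩ := exists_spanning_polynomial (F := F) hH hd
      refine ⟨D, hD, hdeg.trans ?_, fun α hα _ => ⟨t, d, fun i => hH.1 i (mem_univ i),
        fun φ hφ => hspan α hα φ fun i _ => hφ i⟩⟩
      rw [sq]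
      exact Nat.mul_le_mul (Nat.sub_le _ _) (Nat.sub_le _ _)
    · exact ⟨1, one_ne_zero, by simp, fun _ _ h' => absurd h' h⟩
  choose D hD hdeg hspan using key
  let B : Finset (Finset (Fin n)) := {S | #S ≤ n - k}
  have hB : #B = chooseLE n (n - k) := card_filter_card_le n (n - k)
  have hB1 : 1 ≤ #B := card_pos.2 ⟨∅, by simp [B]⟩
  let V : MvPolynomial (Fin n) F :=
    ∏ x ∈ (univ : Finset (Fin n)).offDiag, (MvPolynomial.X x.1 - MvPolynomial.X x.2)
  let W : MvPolynomial (Fin n) F :=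
    ∏ ℓ ∈ Icc 1 L, ∏ E ∈ Fintype.piFinset fun _ : Fin (ℓ + 1) => B, D ℓ E
  refine ⟨V * W, mul_ne_zero ?_ ?_, ?_, fun α hα => ?_⟩
  · refine prod_ne_zero_iff.2 fun x hx => sub_ne_zero.2 fun h => ?_
    exact (mem_offDiag.1 hx).2.2 (MvPolynomial.X_injective h)
  · exact prod_ne_zero_iff.2 fun ℓ _ => prod_ne_zero_iff.2 fun E _ => hD ℓ E
  · have hV : V.totalDegree ≤ n ^ 2 := by
      refine (MvPolynomial.totalDegree_finsetProd _ _).trans ?_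
      refine (sum_le_card_nsmul _ _ 1 fun x _ => ?_).trans ?_
      · exact (MvPolynomial.totalDegree_sub _ _).trans (by simp [MvPolynomial.totalDegree_X])
      · rw [offDiag_card, card_fin, smul_eq_mul, mul_one, sq]
        exact Nat.sub_le _ _
    have hW : W.totalDegree ≤ L * (#B ^ (L + 1) * n ^ 2) := by
      refine (MvPolynomial.totalDegree_finsetProd _ _).trans ?_
      refine (sum_le_card_nsmul _ _ (#B ^ (L + 1) * n ^ 2) fun ℓ hℓ => ?_).trans ?_
      · refine (MvPolynomial.totalDegree_finsetProd _ _).trans ?_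
        refine (sum_le_card_nsmul _ _ (n ^ 2) fun E _ => hdeg ℓ E).trans ?_
        rw [Fintype.card_piFinset, prod_const, card_fin, smul_eq_mul]
        have := (mem_Icc.1 hℓ).2
        exact Nat.mul_le_mul_right _ (Nat.pow_le_pow_right hB1 (by omega))
      · rw [Nat.card_Icc, Nat.add_sub_cancel, smul_eq_mul]
    refine (MvPolynomial.totalDegree_mul _ _).trans ((Nat.add_le_add hV hW).trans ?_)
    rw [← hB]
    -- The `n ^ 2` spent on distinctness is absorbed into a second copy of the bound for `W`; hence
    -- the factor 2.
    have h1 : 1 ≤ L * #B ^ (L + 1) := Nat.mul_pos hL (Nat.pow_pos hB1)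
    calc n ^ 2 + L * (#B ^ (L + 1) * n ^ 2) ≤
          L * #B ^ (L + 1) * n ^ 2 + L * (#B ^ (L + 1) * n ^ 2) :=
        Nat.add_le_add_right (Nat.le_mul_of_pos_left _ h1) _
      _ = _ := by ring
  · rw [map_mul, mul_ne_zero_iff, map_prod, map_prod, prod_ne_zero_iff, prod_ne_zero_iff] at hα
    refine ⟨fun i j hij => ?_, fun ℓ hℓ E hE => ?_⟩
    · by_contra hne
      exact hα.1 (i, j) (by simp [hne]) (by simp [hij])
    · have h1 := hα.2 ℓ hℓ
      rw [map_prod, prod_ne_zero_iff] at h1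
      exact hspan ℓ E α (h1 E (Fintype.mem_piFinset.2 fun i => by simp [B, hE i]))

/-- The probability version of the Schwartz–Zippel lemma over a finite field. -/
lemma one_sub_le_toOuterMeasure_of_eval_ne_zero {n N : ℕ} {F : Type*} [Field F] [Fintype F]
    [DecidableEq F] {P : MvPolynomial (Fin n) F} (hP : P ≠ 0) (hdeg : P.totalDegree ≤ N)
    {A : Set (Fin n → F)} (hA : ∀ α : Fin n → F, MvPolynomial.eval α P ≠ 0 → α ∈ A) :
    1 - (N : ℝ) / Fintype.card F ≤
      ((PMF.uniformOfFintype (Fin n → F)).toOuterMeasure A).toReal := by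
  classical
  have hq : (0 : ℝ) < Fintype.card (Fin n → F) := by exact_mod_cast Fintype.card_pos
  have hSZ := MvPolynomial.schwartz_zippel_totalDegree hP (univ : Finset F)
  have hSZ' : (#{α : Fin n → F | MvPolynomial.eval α P = 0} : ℝ) / Fintype.card (Fin n → F) ≤
      P.totalDegree / Fintype.card F := by
    have := (NNRat.cast_le (K := ℝ)).2 hSZ
    push_cast [Fintype.piFinset_univ, card_univ] at this
    rw [Fintype.card_fun, Fintype.card_fin]
    push_cast
    exact this
  have hcard : (Fintype.card (Fin n → F) : ℝ) ≤
      Fintype.card A + #{α : Fin n → F | MvPolynomial.eval α P = 0} := by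
    have h1 := card_filter_add_card_filter_not (s := (univ : Finset (Fin n → F)))
      (fun α => MvPolynomial.eval α P = 0)
    have h2 : #{α : Fin n → F | ¬MvPolynomial.eval α P = 0} ≤ Fintype.card A := by
      rw [← Set.toFinset_card]
      exact card_le_card fun α hα => Set.mem_toFinset.2 (hA α (by simpa using hα))
    rw [card_univ] at h1
    exact_mod_cast (by omega : Fintype.card (Fin n → F) ≤
      Fintype.card A + #{α : Fin n → F | MvPolynomial.eval α P = 0})
  rw [PMF.toOuterMeasure_uniformOfFintype_apply, ENNReal.toReal_div, ENNReal.toReal_natCast,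
    ENNReal.toReal_natCast]
  have hN : (P.totalDegree : ℝ) / Fintype.card F ≤ N / Fintype.card F := by gcongr
  have h3 : 1 ≤ (Fintype.card A : ℝ) / Fintype.card (Fin n → F) +
      #{α : Fin n → F | MvPolynomial.eval α P = 0} / Fintype.card (Fin n → F) := by
    rw [← add_div, one_le_div hq]
    exact hcard
  linarith

theorem theorem1p2 (n k L : ℕ) (hn : 0 < n) (hk : 0 < k) (hkn : k ≤ n) (hL : 0 < L)
    (F : Type*) [Field F] [Fintype F] [DecidableEq F] :
    1 - ((2 * L * n ^ 2 * chooseLE n (n - k) ^ (L + 1) : ℕ) : ℝ) / (Fintype.card F : ℝ) ≤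
      ((PMF.uniformOfFintype (Fin n → F)).toOuterMeasure
        {α : Fin n → F |
          Function.Injective α ∧
          Module.finrank F (reedSolomonCode k α) = k ∧
          IsLDMDSLE (reedSolomonCode k α) L ∧
          IsAvgRadiusListDecodable (reedSolomonCode k α)
            (1 - (k : ℝ) / n - (1 - (k : ℝ) / n) / ((L : ℝ) + 1)) L ∧
          ∀ ℓ : ℕ, 1 ≤ ℓ → ℓ ≤ L →
            IsListDecodable (reedSolomonCode k α)
              ((ℓ : ℝ) / ((ℓ : ℝ) + 1) * (1 - (k : ℝ) / n)) ℓ}).toReal := by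
  obtain ⟨P, hP, hdeg, hgood⟩ := exists_polynomial_good n k L hL F
  refine one_sub_le_toOuterMeasure_of_eval_ne_zero hP hdeg fun α hα => ?_
  obtain ⟨hinj, hspan⟩ := hgood α hα
  have hdim := finrank_reedSolomonCode hinj hkn
  have havg : ∀ ℓ : ℕ, 1 ≤ ℓ → ℓ ≤ L → IsAvgRadiusListDecodable (reedSolomonCode k α)
      ((ℓ : ℝ) / ((ℓ : ℝ) + 1) * (1 - (k : ℝ) / n)) ℓ := fun ℓ h1 h2 =>
    isAvgRadiusListDecodable_of_lt hn hkn fun T hT hcard y => by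
      have := lt_sum_hammingNorm_of_spanning hinj hspan hT (by omega) (by omega) y
      rwa [hcard, Nat.add_sub_cancel] at this
  refine ⟨hinj, hdim, fun ℓ h1 h2 => ?_, ?_, fun ℓ h1 h2 => (havg ℓ h1 h2).isListDecodable⟩
  · rw [IsLDMDS, hdim]
    exact havg ℓ h1 h2
  · have hL' : (L : ℝ) + 1 ≠ 0 := by positivity
    have := havg L hL le_rfl
    rwa [show (L : ℝ) / ((L : ℝ) + 1) * (1 - (k : ℝ) / n) =
      1 - (k : ℝ) / n - (1 - (k : ℝ) / n) / ((L : ℝ) + 1) by field_simp; ring] at this
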